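/- Let $N \ge 1$ be an integer and let $\theta \in \mathbb{C}$ be a primitive $N$-th root of unity. Let $S_{KNW}$ denote the space of continuous functions $f : \mathbb{C} \to \mathbb{C}$ which solve the Kakutani–Nagumo–Walsh equation $$\frac{1}{N}\sum_{k=0}^{N-1} f(x+\theta^k y) = f(x) \quad \text{for all } x, y \in \mathbb{C}.$$ Then $$S_{KNW} = \{\, a_0 + a_1 z + \cdots + a_{N-1} z^{N-1} + b_1 \overline{z} + \cdots + b_{N-1} \overline{z}^{\,N-1} : (a_0,\dots,a_{N-1},b_1,\dots,b_{N-1}) \in \mathbb{C}^{2N-1} \,\},$$ and $S_{KNW}$ is a complex vector space of dimension $2N-1$. -/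

import Mathlib

/-- The space of continuous `f : ℂ → ℂ` which solve the Kakutani-Nagumo-Walsh equation
`(1 / N) * ∑_{k < N} f (x + θ ^ k * y) = f x` for all `x y : ℂ`, as a complex vector subspace
of the space of all continuous functions. -/
def kakutaniNagumoWalshSpace (N : ℕ) (θ : ℂ) : Submodule ℂ C(ℂ, ℂ) where
  carrier := {f : C(ℂ, ℂ) | ∀ x y : ℂ,
    (1 / (N : ℂ)) * ∑ k ∈ Finset.range N, f (x + θ ^ k * y) = f x}
  zero_mem' := by
    intro x y
    simp
  add_mem' := by
    intro f g hf hg x y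
    have h1 := hf x y
    have h2 := hg x y
    simp only [ContinuousMap.add_apply, Finset.sum_add_distrib, mul_add]
    rw [h1, h2]
  smul_mem' := by
    intro c f hf x y
    have h1 := hf x y
    simp only [ContinuousMap.smul_apply, smul_eq_mul, ← Finset.mul_sum]
    rw [mul_left_comm, h1]

/-!
The equation says that `f x` is the mean of `f` over the vertices of every regular `N`-gon centred
at `x`. Integrating it in `y` against a smooth radial weight `φ` of compact support,
the rotation invariance of `φ` and of Lebesgue measure turns the left-hand side into `φ ⋆ f`,
up to a constant factor, so `f` is a multiple of `φ ⋆ f` and hence smooth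
(`contDiff_of_averaging`). Differentiating twice in `y` at `0`, in the directions `1` and `I`, shows
that `f` is harmonic
(`harmonicOnNhd_of_averaging`).

A real-valued solution is therefore the real part of an entire function `F`. The real part of
`∑ F (x + θ ^ k * y) - N * F x`, which is entire in `y`, vanishes, so this function is constant and
`F` solves the equation too. Differentiating `N` times in `y` at `0`, where `(θ ^ k) ^ N = 1`, gives
`F⁽ᴺ⁾ = 0`: `F` is a polynomial of degree less than `N` (`exists_polynomial_of_averaging`).
Applying this to the real and imaginary parts of `f` gives one inclusion. The other is the binomial
expansion, in which the power sums `∑ (θ ^ k) ^ m` with `0 < m < N` vanish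
(`averaging_pow`).

For the dimension, the `2 * N - 1` coefficients are determined by the function: if `P + conj Q = 0`
with `P`, `Q` entire, then `Re (P + Q) = 0` and `Re (I * (P - Q)) = 0`, so `P` and `Q` are constant
(`eq_of_add_conj_eq_zero`).
-/

open Complex MeasureTheory InnerProductSpace
open scoped Convolution ContDiff ComplexConjugate

/-! ### Regularity of solutions -/

/-- A smooth radial weight on `ℂ`, positive exactly on the open unit disc. -/
noncomputable def radialBump (z : ℂ) : ℝ := Real.smoothTransition (1 - ‖z‖ ^ 2)

lemma contDiff_radialBump : ContDiff ℝ ∞ radialBump :=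
  Real.smoothTransition.contDiff.comp (contDiff_const.sub (contDiff_norm_sq ℝ))

lemma hasCompactSupport_radialBump : HasCompactSupport radialBump := by
  refine HasCompactSupport.intro (isCompact_closedBall (0 : ℂ) 1) fun z hz => ?_
  rw [Metric.mem_closedBall, dist_zero_right, not_le] at hz
  exact Real.smoothTransition.zero_of_nonpos (by nlinarith)

lemma integral_radialBump_pos : 0 < ∫ z, radialBump z :=
  contDiff_radialBump.continuous.integral_pos_of_hasCompactSupport_nonneg_nonzero
    hasCompactSupport_radialBump (fun _ => Real.smoothTransition.nonneg _)
    (x := 0) (by simp [radialBump])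

/-- The equation, integrated in `y` against the radial weight, expresses a solution as a multiple
of its own mollification. -/
lemma contDiff_of_averaging {N : ℕ} (hN : 1 ≤ N) {θ : ℂ} (hθ : ‖θ‖ = 1) {f : ℂ → ℝ}
    (hf : Continuous f)
    (h : ∀ x y : ℂ, ∑ k ∈ Finset.range N, f (x + θ ^ k * y) = N * f x) :
    ContDiff ℝ ∞ f := by
  have hφ := contDiff_radialBump.continuous
  have hconv : ContDiff ℝ ∞ (radialBump ⋆[ContinuousLinearMap.lsmul ℝ ℝ, volume] f) :=
    hasCompactSupport_radialBump.contDiff_convolution_left _ contDiff_radialBump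
      hf.locallyIntegrable
  have hrot : ∀ (x : ℂ) (k : ℕ), ∫ t, radialBump t * f (x + θ ^ k * -t) =
      ∫ t, radialBump t * f (x - t) := by
    intro x k
    have hu : θ ^ k ∈ Submonoid.unitSphere ℂ := by simp [Submonoid.unitSphere, hθ]
    let e := rotation (⟨θ ^ k, hu⟩ : Circle)
    rw [← e.measurePreserving.integral_comp e.toHomeomorph.measurableEmbedding
      fun t => radialBump t * f (x - t)]
    refine integral_congr_ae (.of_forall fun t => ?_)
    have het : e t = θ ^ k * t := rotation_apply _ _
    have hφt : radialBump (θ ^ k * t) = radialBump t := by simp [radialBump, hθ]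
    simp only [het, hφt, mul_neg, sub_eq_add_neg]
  have hint : ∀ (x : ℂ) (k : ℕ), Integrable fun t => radialBump t * f (x + θ ^ k * -t) :=
    fun x k => Continuous.integrable_of_hasCompactSupport (by fun_prop)
      hasCompactSupport_radialBump.mul_right
  have key : ∀ x, (∫ t, radialBump t) * f x =
      (radialBump ⋆[ContinuousLinearMap.lsmul ℝ ℝ, volume] f) x := by
    intro x
    have hN' : (N : ℝ) ≠ 0 := by positivity
    apply mul_left_cancel₀ hN'
    calc (N : ℝ) * ((∫ t, radialBump t) * f x)
        = ∫ t, radialBump t * (N * f x) := by rw [integral_mul_const]; ring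
      _ = ∫ t, ∑ k ∈ Finset.range N, radialBump t * f (x + θ ^ k * -t) := by
          simp_rw [← Finset.mul_sum, h]
      _ = ∑ k ∈ Finset.range N, ∫ t, radialBump t * f (x + θ ^ k * -t) :=
          integral_finsetSum _ fun k _ => hint x k
      _ = _ := by
          rw [Finset.sum_congr rfl fun k _ => hrot x k]
          simp [convolution_def]
  have hfeq : f = fun x => (∫ t, radialBump t)⁻¹ *
      (radialBump ⋆[ContinuousLinearMap.lsmul ℝ ℝ, volume] f) x := by
    funext x
    rw [← key, inv_mul_cancel_left₀ integral_radialBump_pos.ne']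
  rw [hfeq]
  exact contDiff_const.mul hconv

/-- The trace `B 1 1 + B I I` of a real bilinear form on `ℂ` can be computed in any rotated frame
`c`, `c * I`. -/
lemma trace_rotate (B : ℂ →L[ℝ] ℂ →L[ℝ] ℝ) {c : ℂ} (hc : ‖c‖ = 1) :
    B c c + B (c * I) (c * I) = B 1 1 + B I I := by
  have h1 : c = c.re • (1 : ℂ) + c.im • I := by simp
  have h2 : c * I = (-c.im) • (1 : ℂ) + c.re • I := by
    apply Complex.ext <;> simp
  have hn : c.re * c.re + c.im * c.im = 1 := by
    rw [← normSq_apply, normSq_eq_norm_sq, hc, one_pow]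
  have e1 : B c c = c.re * (c.re * B 1 1 + c.im * B 1 I)
      + c.im * (c.re * B I 1 + c.im * B I I) := by
    conv_lhs => rw [h1]
    simp only [map_add, map_smul, add_apply, smul_apply,
      smul_eq_mul]
    ring
  have e2 : B (c * I) (c * I) = -c.im * (-c.im * B 1 1 + c.re * B 1 I)
      + c.re * (-c.im * B I 1 + c.re * B I I) := by
    rw [h2]
    simp only [map_add, map_smul, add_apply, smul_apply,
      smul_eq_mul]
    ring
  rw [e1, e2]
  linear_combination (B 1 1 + B I I) * hn

/-- The second derivative in `y` at `0`, in direction `v`, of the left-hand side is the sum of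
`D²f x (θ ^ k * v, θ ^ k * v)` over `k`; adding up the directions `v = 1` and `v = I` yields
`N * Δ f x = 0`. -/
lemma harmonicOnNhd_of_averaging {N : ℕ} (hN : 1 ≤ N) {θ : ℂ} (hθ : ‖θ‖ = 1) {f : ℂ → ℝ}
    (hf : Continuous f)
    (h : ∀ x y : ℂ, ∑ k ∈ Finset.range N, f (x + θ ^ k * y) = N * f x) :
    HarmonicOnNhd f Set.univ := by
  have hs : ContDiff ℝ 2 f := (contDiff_of_averaging hN hθ hf h).of_le (WithTop.coe_le_coe.2 le_top)
  have hD : ∀ (x v : ℂ),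
      ∑ k ∈ Finset.range N, iteratedFDeriv ℝ 2 f x ![θ ^ k * v, θ ^ k * v] = 0 := by
    intro x v
    have hterm : ∀ k : ℕ, iteratedFDeriv ℝ 2 (fun y => f (x + θ ^ k * y)) 0 ![v, v] =
        iteratedFDeriv ℝ 2 f x ![θ ^ k * v, θ ^ k * v] := by
      intro k
      have := (ContinuousLinearMap.mul ℝ ℂ (θ ^ k)).iteratedFDeriv_comp_right
        (f := fun y => f (x + y)) (n := 2) (hs.comp (contDiff_const.add contDiff_id)) 0
        (i := 2) le_rfl
      rw [iteratedFDeriv_comp_add_left'] at this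
      have h2 := congrArg (fun B => B ![v, v]) this
      simp only [Function.comp_def, ContinuousLinearMap.mul_apply', mul_zero, add_zero,
        ContinuousMultilinearMap.compContinuousLinearMap_apply] at h2
      rw [h2]
      congr 1
      ext i
      fin_cases i <;> rfl
    have hsum := iteratedFDeriv_fun_sum_apply (𝕜 := ℝ) (n := 2) (u := Finset.range N) (x := (0 : ℂ))
      (f := fun k y => f (x + θ ^ k * y))
      fun k _ => (hs.comp (contDiff_const.add (contDiff_const.mul contDiff_id))).contDiffAt
    simp_rw [← hterm]
    rw [← sum_apply, ← hsum]
    simp_rw [h]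
    rw [iteratedFDeriv_const_of_ne two_ne_zero]
    rfl
  intro x _
  refine ⟨hs.contDiffAt, .of_forall fun z => ?_⟩
  rw [laplacian_eq_iteratedFDeriv_complexPlane]
  have h1 := hD z 1
  have hI := hD z I
  simp only [iteratedFDeriv_two_apply, Matrix.cons_val_zero, Matrix.cons_val_one, mul_one]
    at h1 hI ⊢
  have hsum := Finset.sum_congr rfl fun k (_ : k ∈ Finset.range N) =>
    trace_rotate (fderiv ℝ (fderiv ℝ f) z) (c := θ ^ k) (by simp [hθ])
  rw [Finset.sum_add_distrib, h1, hI] at hsum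
  simpa [show N ≠ 0 by omega, ← mul_add] using hsum.symm

/-! ### Entire solutions -/

lemma apply_eq_apply_zero_of_re_eq_zero {G : ℂ → ℂ} (hG : Differentiable ℂ G)
    (h : ∀ z, (G z).re = 0) (z : ℂ) : G z = G 0 := by
  obtain ⟨c, hc⟩ := AnalyticOnNhd.eq_const_of_re_eq_const (U := Set.univ) (c₀ := 0)
    (hG.differentiableOn.analyticOnNhd isOpen_univ) (fun x _ => h x) isOpen_univ
    isConnected_univ
  rw [hc z (Set.mem_univ z), hc 0 (Set.mem_univ 0)]

/-- If `P + conj Q = 0` with `P` and `Q` entire, then both are constant. -/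
lemma eq_of_add_conj_eq_zero {P Q : ℂ → ℂ} (hP : Differentiable ℂ P) (hQ : Differentiable ℂ Q)
    (h : ∀ z, P z + conj (Q z) = 0) (z : ℂ) : P z = P 0 ∧ Q z = Q 0 := by
  have hre : ∀ z, (P z).re + (Q z).re = 0 := fun z => by simpa using congrArg re (h z)
  have him : ∀ z, (P z).im - (Q z).im = 0 := fun z => by
    simpa [sub_eq_add_neg] using congrArg im (h z)
  have h1 := apply_eq_apply_zero_of_re_eq_zero (hP.add hQ) (fun z => by simpa using hre z) z
  have h2 := apply_eq_apply_zero_of_re_eq_zero ((hP.sub hQ).const_mul I)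
    (fun z => by simpa [sub_eq_zero] using (sub_eq_zero.1 (him z)).symm) z
  have h3 := mul_left_cancel₀ I_ne_zero h2
  simp only [Pi.add_apply, Pi.sub_apply] at h1 h3
  constructor
  · linear_combination (h1 + h3) / 2
  · linear_combination (h1 - h3) / 2

/-- Since `(θ ^ k) ^ N = 1`, each summand of the left-hand side has `N`-th derivative `F⁽ᴺ⁾ x` in
`y` at `0`, while the right-hand side does not depend on `y`. -/
lemma iteratedDeriv_eq_zero_of_averaging {N : ℕ} (hN : 1 ≤ N) {θ : ℂ} (hθ : θ ^ N = 1)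
    {F : ℂ → ℂ} (hF : Differentiable ℂ F)
    (h : ∀ x y : ℂ, ∑ k ∈ Finset.range N, F (x + θ ^ k * y) = N * F x) (x : ℂ) :
    iteratedDeriv N F x = 0 := by
  have hs : ContDiff ℂ N fun y => F (x + y) := (hF.comp (differentiable_id.const_add x)).contDiff
  have hsum := iteratedDeriv_fun_sum (n := N) (I := Finset.range N) (x := (0 : ℂ))
    (f := fun k y => F (x + θ ^ k * y))
    fun k _ => (hs.comp (contDiff_const.mul contDiff_id)).contDiffAt
  simp_rw [h] at hsum
  have hterm : ∀ k : ℕ, iteratedDeriv N (fun y => F (x + θ ^ k * y)) 0 = iteratedDeriv N F x := by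
    intro k
    rw [iteratedDeriv_comp_const_mul (f := fun y => F (x + y)) hs, iteratedDeriv_comp_const_add]
    simp only [← pow_mul, mul_comm k N]
    simp [pow_mul, hθ]
  simp_rw [hterm] at hsum
  rw [iteratedDeriv_const, if_neg (by omega)] at hsum
  simpa [show N ≠ 0 by omega] using hsum.symm

lemma exists_polynomial_of_iteratedDeriv_eq_zero {N : ℕ} {F : ℂ → ℂ} (hF : Differentiable ℂ F)
    (h : ∀ x, iteratedDeriv N F x = 0) :
    ∃ p : Fin N → ℂ, ∀ z, F z = ∑ k : Fin N, p k * z ^ (k : ℕ) := by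
  have hzero : ∀ n, iteratedDeriv (N + n) F = 0 := by
    intro n
    induction n with
    | zero => exact funext h
    | succ n ih =>
      rw [← add_assoc, iteratedDeriv_succ, ih]
      exact deriv_const' 0
  refine ⟨fun k => ((k : ℕ).factorial : ℂ)⁻¹ * iteratedDeriv k F 0, fun z => ?_⟩
  rw [← Complex.taylorSeries_eq_of_entire' 0 z hF, tsum_eq_sum (s := Finset.range N),
    Finset.sum_range]
  · simp
  · intro n hn
    obtain ⟨m, rfl⟩ := Nat.exists_eq_add_of_le (not_lt.1 (mt Finset.mem_range.2 hn))
    simp [hzero m]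

/-- Real-valued continuous solutions are real parts of polynomials of degree less than `N`. -/
lemma exists_polynomial_of_averaging {N : ℕ} (hN : 1 ≤ N) {θ : ℂ} (hθ : θ ^ N = 1) {f : ℂ → ℝ}
    (hf : Continuous f)
    (h : ∀ x y : ℂ, ∑ k ∈ Finset.range N, f (x + θ ^ k * y) = N * f x) :
    ∃ p : Fin N → ℂ, ∀ z, f z = (∑ k : Fin N, p k * z ^ (k : ℕ)).re := by
  have hnorm : ‖θ‖ = 1 := norm_eq_one_of_pow_eq_one hθ (by omega)
  obtain ⟨F, hF, rfl⟩ := (harmonicOnNhd_of_averaging hN hnorm hf h).exists_analyticOnNhd_univ_re_eq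
  have hFd : Differentiable ℂ F := fun z => (hF z (Set.mem_univ z)).differentiableAt
  have hFeq : ∀ x y : ℂ, ∑ k ∈ Finset.range N, F (x + θ ^ k * y) = N * F x := by
    intro x y
    have hd : Differentiable ℂ fun y => (∑ k ∈ Finset.range N, F (x + θ ^ k * y)) - N * F x := by
      fun_prop
    have := apply_eq_apply_zero_of_re_eq_zero hd (fun y => by simpa [sub_eq_zero] using h x y) y
    simpa [sub_eq_zero] using this
  obtain ⟨p, hp⟩ := exists_polynomial_of_iteratedDeriv_eq_zero hFd
    (iteratedDeriv_eq_zero_of_averaging hN hθ hFd hFeq)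
  exact ⟨p, fun z => congrArg re (hp z)⟩

/-! ### Powers are solutions -/

lemma sum_pow_pow_eq_zero {N : ℕ} {θ : ℂ} (hθ : IsPrimitiveRoot θ N) {m : ℕ} (hm : m ≠ 0)
    (hmN : m < N) : ∑ k ∈ Finset.range N, (θ ^ k) ^ m = 0 := by
  have h1 : θ ^ m ≠ 1 := hθ.pow_ne_one_of_pos_of_lt hm hmN
  simp_rw [← pow_mul, mul_comm _ m, pow_mul]
  rw [geom_sum_eq h1, ← pow_mul, mul_comm, pow_mul, hθ.pow_eq_one, one_pow, sub_self, zero_div]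

lemma averaging_pow {N : ℕ} {θ : ℂ} (hθ : IsPrimitiveRoot θ N) {j : ℕ} (hj : j < N) (x y : ℂ) :
    ∑ k ∈ Finset.range N, (x + θ ^ k * y) ^ j = N * x ^ j := by
  -- In the expansion in powers of `θ ^ k * y`, only the constant term survives the sum over `k`.
  simp_rw [add_comm x, add_pow]
  rw [Finset.sum_comm, Finset.sum_range_succ']
  have hz : ∀ m ∈ Finset.range j, ∑ k ∈ Finset.range N,
      (θ ^ k * y) ^ (m + 1) * x ^ (j - (m + 1)) * (j.choose (m + 1) : ℂ) = 0 := by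
    intro m hm
    have := Finset.mem_range.1 hm
    simp_rw [mul_pow, mul_assoc]
    rw [← Finset.sum_mul, sum_pow_pow_eq_zero hθ m.succ_ne_zero (by omega), zero_mul]
  rw [Finset.sum_eq_zero hz]
  simp

lemma averaging_conj_pow {N : ℕ} {θ : ℂ} (hθ : IsPrimitiveRoot θ N) {j : ℕ} (hj : j < N)
    (x y : ℂ) : ∑ k ∈ Finset.range N, conj (x + θ ^ k * y) ^ j = N * conj x ^ j := by
  simpa using congrArg conj (averaging_pow hθ hj x y)

/-! ### Parametrization by coefficients -/

/-- The linear map sending coefficients `(a, b)` to the function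
`∑_{k < N} a k * z ^ k + ∑_{k < N - 1} b k * conj z ^ (k + 1)`. -/
noncomputable def bipolynomial (N : ℕ) :
    ((Fin N → ℂ) × (Fin (N - 1) → ℂ)) →ₗ[ℂ] C(ℂ, ℂ) where
  toFun c := ⟨fun z => (∑ k : Fin N, c.1 k * z ^ (k : ℕ)) +
    ∑ k : Fin (N - 1), c.2 k * conj z ^ ((k : ℕ) + 1), by fun_prop⟩
  map_add' c d := by
    ext z
    simp only [Prod.fst_add, Prod.snd_add, Pi.add_apply, add_mul, Finset.sum_add_distrib,
      ContinuousMap.coe_mk, ContinuousMap.add_apply]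
    ring
  map_smul' r c := by
    ext z
    simp [mul_add, Finset.mul_sum, mul_assoc]

lemma bipolynomial_apply (N : ℕ) (c : (Fin N → ℂ) × (Fin (N - 1) → ℂ)) (z : ℂ) :
    bipolynomial N c z = (∑ k : Fin N, c.1 k * z ^ (k : ℕ)) +
      ∑ k : Fin (N - 1), c.2 k * conj z ^ ((k : ℕ) + 1) := rfl

lemma eq_zero_of_sum_mul_pow_eq_zero {n : ℕ} {a : Fin n → ℂ}
    (h : ∀ z : ℂ, ∑ k : Fin n, a k * z ^ (k : ℕ) = 0) : a = 0 := by
  have hp : ∑ k : Fin n, Polynomial.monomial (k : ℕ) (a k) = 0 :=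
    Polynomial.funext fun z => by simpa [Polynomial.eval_finsetSum] using h z
  funext j
  have := congrArg (fun p => p.coeff (j : ℕ)) hp
  simpa [Polynomial.finsetSum_coeff, Polynomial.coeff_monomial, Fin.val_inj] using this

lemma bipolynomial_injective (N : ℕ) : Function.Injective (bipolynomial N) := by
  rw [← LinearMap.ker_eq_bot, LinearMap.ker_eq_bot']
  rintro ⟨a, b⟩ hab
  have h : ∀ z : ℂ, (∑ k : Fin N, a k * z ^ (k : ℕ)) +
      conj (∑ k : Fin (N - 1), conj (b k) * z ^ ((k : ℕ) + 1)) = 0 := fun z => by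
    simpa [bipolynomial_apply] using congrArg (fun g : C(ℂ, ℂ) => g z) hab
  have hconst := eq_of_add_conj_eq_zero (P := fun z => ∑ k : Fin N, a k * z ^ (k : ℕ))
    (Q := fun z => ∑ k : Fin (N - 1), conj (b k) * z ^ ((k : ℕ) + 1))
    (by fun_prop) (by fun_prop) h
  have hQ : ∀ z : ℂ, ∑ k : Fin (N - 1), conj (b k) * z ^ ((k : ℕ) + 1) = 0 := fun z => by
    simpa using (hconst z).2
  have ha : a = 0 := eq_zero_of_sum_mul_pow_eq_zero fun z => by simpa [hQ z] using h z
  -- Shifting the coefficients of `Q` by one turns it into a sum over `Fin (N - 1 + 1)`.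
  have hb : (Fin.cons 0 fun k => conj (b k) : Fin (N - 1 + 1) → ℂ) = 0 :=
    eq_zero_of_sum_mul_pow_eq_zero fun z => by simpa [Fin.sum_univ_succ] using hQ z
  refine Prod.ext ha (funext fun k => ?_)
  simpa using congrFun hb k.succ

lemma bipolynomial_mem {N : ℕ} (hN : 1 ≤ N) {θ : ℂ} (hθ : IsPrimitiveRoot θ N)
    (c : (Fin N → ℂ) × (Fin (N - 1) → ℂ)) :
    bipolynomial N c ∈ kakutaniNagumoWalshSpace N θ := by
  intro x y
  have hN' : (N : ℂ) ≠ 0 := by exact_mod_cast (show N ≠ 0 by omega)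
  rw [one_div, inv_mul_eq_iff_eq_mul₀ hN']
  simp_rw [bipolynomial_apply]
  rw [Finset.sum_add_distrib, Finset.sum_comm, Finset.sum_comm (s := Finset.range N)]
  simp_rw [← Finset.mul_sum]
  rw [mul_add, Finset.mul_sum, Finset.mul_sum]
  congr 1
  · refine Finset.sum_congr rfl fun k _ => ?_
    rw [averaging_pow hθ k.2]
    ring
  · refine Finset.sum_congr rfl fun k _ => ?_
    rw [averaging_conj_pow hθ (by omega)]
    ring

lemma exists_bipolynomial_eq {N : ℕ} (hN : 1 ≤ N) {θ : ℂ} (hθ : IsPrimitiveRoot θ N)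
    {f : C(ℂ, ℂ)} (hf : f ∈ kakutaniNagumoWalshSpace N θ) : ∃ c, bipolynomial N c = f := by
  have hN' : (N : ℂ) ≠ 0 := by exact_mod_cast (show N ≠ 0 by omega)
  have h : ∀ x y : ℂ, ∑ k ∈ Finset.range N, f (x + θ ^ k * y) = N * f x := fun x y => by
    have := hf x y
    rwa [one_div, inv_mul_eq_iff_eq_mul₀ hN'] at this
  obtain ⟨p, hp⟩ := exists_polynomial_of_averaging hN hθ.pow_eq_one (f := fun z => (f z).re)
    (by fun_prop) fun x y => by simpa using congrArg re (h x y)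
  obtain ⟨q, hq⟩ := exists_polynomial_of_averaging hN hθ.pow_eq_one (f := fun z => (f z).im)
    (by fun_prop) fun x y => by simpa using congrArg im (h x y)
  obtain ⟨n, rfl⟩ : ∃ n, N = n + 1 := ⟨N - 1, by omega⟩
  -- `Re P + I * Re Q = (P + I * Q) / 2 + (conj P + I * conj Q) / 2`; the constant terms of both
  -- halves go into `a 0`.
  refine ⟨(fun k => (p k + I * q k) / 2 +
      if k = 0 then (conj (p 0) + I * conj (q 0)) / 2 else 0,
    fun k => (conj (p k.succ) + I * conj (q k.succ)) / 2), ?_⟩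
  ext z
  have hfz : f z = ((f z).re : ℂ) + I * ((f z).im : ℂ) := by
    rw [mul_comm]; exact (re_add_im _).symm
  rw [hfz, hp, hq, re_eq_add_conj, re_eq_add_conj, bipolynomial_apply]
  -- Replaces the index type `Fin (n + 1 - 1)` by the definitionally equal `Fin n`.
  change _ + (∑ k : Fin n, (conj (p k.succ) + I * conj (q k.succ)) / 2 * _ ^ ((k : ℕ) + 1)) = _
  simp only [Fin.sum_univ_succ, map_add, map_sum, map_mul, map_pow]
  simp only [Fin.val_zero, pow_zero, mul_one, if_true, Fin.val_succ, Fin.succ_ne_zero, if_false,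
    add_zero, add_mul, add_div, div_mul_eq_mul_div, Finset.sum_add_distrib, ← Finset.sum_div,
    mul_assoc, ← Finset.mul_sum]
  ring

theorem mainTheorem2 (N : ℕ) (hN : 1 ≤ N) (θ : ℂ) (hθ : IsPrimitiveRoot θ N) :
    (kakutaniNagumoWalshSpace N θ : Set C(ℂ, ℂ)) =
        {f : C(ℂ, ℂ) | ∃ (a : Fin N → ℂ) (b : Fin (N - 1) → ℂ), ∀ z : ℂ,
          f z = (∑ k : Fin N, a k * z ^ (k : ℕ)) +
            ∑ k : Fin (N - 1), b k * (starRingEnd ℂ z) ^ ((k : ℕ) + 1)} ∧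
      Module.finrank ℂ (kakutaniNagumoWalshSpace N θ) = 2 * N - 1 := by
  constructor
  · ext f
    constructor
    · intro hf
      obtain ⟨c, rfl⟩ := exists_bipolynomial_eq hN hθ hf
      exact ⟨c.1, c.2, fun z => bipolynomial_apply N c z⟩
    · rintro ⟨a, b, hab⟩
      have hfe : f = bipolynomial N (a, b) := ContinuousMap.ext hab
      rw [hfe]
      exact bipolynomial_mem hN hθ (a, b)
  · have hrange : kakutaniNagumoWalshSpace N θ = LinearMap.range (bipolynomial N) :=
      le_antisymm (fun _ hf => exists_bipolynomial_eq hN hθ hf)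
        (by rintro _ ⟨c, rfl⟩; exact bipolynomial_mem hN hθ c)
    rw [hrange, LinearMap.finrank_range_of_inj (bipolynomial_injective N)]
    simp only [Module.finrank_prod, Module.finrank_fintype_fun_eq_card, Fintype.card_fin]
    omega
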